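/- Let $\mathbb{T}$ be the unit circle with normalised arc length, let $H^2\subset L^2(\mathbb{T})$ be the Hardy space of functions whose Fourier coefficients of negative index vanish, let $\mathbb{P}$ be the orthogonal (Riesz) projection of $L^2(\mathbb{T})$ onto $H^2$, and write $f(0)$ for the zeroth Fourier coefficient of $f\in H^2$. Let $T_z$ be multiplication by $z$ on $H^2$. Let $\mathrm{Rat}_0(\mathbb{T})$ be the set of strictly proper rational complex functions (including $0$) all of whose poles lie on $\mathbb{T}$. For a rational complex function $\omega$, possibly with poles on $\mathbb{T}$, let $T_\omega\,(H^2\to H^2)$ be the unbounded operator given by $$\mathrm{Dom}(T_\omega)=\{g\in H^2 : \omega g=f+\rho \text{ with } f\in L^2(\mathbb{T}),\ \rho\in \mathrm{Rat}_0(\mathbb{T})\},\qquad T_\omega g=\mathbb{P}f$$ (this is well defined, since $L^2(\mathbb{T})\cap\mathrm{Rat}_0(\mathbb{T})=\{0\}$). Proposition. For every rational complex function $\omega$, $T=T_\omega$ is a Sarason-Toeplitz operator on $H^2$; that is, $T$ is closed and densely defined, and 1. $T_z\,\mathrm{Dom}(T)\subset \mathrm{Dom}(T)$; 2. $T_z^*\,T\,T_z=T$,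 as unbounded operators (with equality of the domains, where $\mathrm{Dom}(T_z^*TT_z)=\{f\in H^2: T_zf\in\mathrm{Dom}(T)\}$); 3. if $f\in \mathrm{Dom}(T)$ and $f(0)=0$, then $T_z^*f\in\mathrm{Dom}(T)$. -/

import Mathlib

open MeasureTheory AddCircle

open scoped ENNReal InnerProduct

noncomputable section

/-- `L²(𝕋)`: the unit circle is parametrised by `ℝ/ℤ` through `x ↦ AddCircle.toCircle x = e^{2πix}`
and carries normalised arc length. -/
abbrev L2T : Type := Lp ℂ 2 (haarAddCircle : Measure UnitAddCircle)

/-- The Hardy space `H²`: the functions in `L²(𝕋)` whose Fourier coefficients of negative index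
vanish. -/
def H2 : Submodule ℂ L2T where
  carrier := {f | ∀ n : ℤ, n < 0 → fourierCoeff f n = 0}
  zero_mem' := by
    intro n _
    rw [← fourierBasis_repr]
    simp
  add_mem' := by
    intro f g hf hg n hn
    have h1 := hf n hn
    have h2 := hg n hn
    rw [← fourierBasis_repr] at h1 h2 ⊢
    simp [h1, h2]
  smul_mem' := by
    intro c f hf n hn
    have h1 := hf n hn
    rw [← fourierBasis_repr] at h1 ⊢
    simp [h1]

theorem mem_H2_iff (f : L2T) : f ∈ H2 ↔ ∀ n : ℤ, n < 0 → fourierCoeff f n = 0 := Iff.rfl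

theorem isClosed_H2 : IsClosed (H2 : Set L2T) := by
  have h : (H2 : Set L2T) = ⋂ (n : ℤ) (_ : n < 0), {f : L2T | fourierBasis.repr f n = 0} := by
    ext f
    simp only [SetLike.mem_coe, mem_H2_iff, Set.mem_iInter, Set.mem_ofPred_eq, fourierBasis_repr]
  rw [h]
  refine isClosed_iInter fun n => isClosed_iInter fun _ => isClosed_eq ?_ continuous_const
  have h2 : (fun f : L2T => fourierBasis.repr f n) = fun f : L2T => inner ℂ (fourierBasis n) f := by
    funext f
    exact fourierBasis.repr_apply_apply f n
  rw [h2]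
  fun_prop

instance instCompleteSpaceH2 : CompleteSpace H2 := isClosed_H2.completeSpace_coe

/-- The Riesz projection of `L²(𝕋)` onto `H²`; for the exponent `2` it is the orthogonal
projection. -/
def rieszProj : L2T →L[ℂ] H2 := H2.orthogonalProjectionOnto

/-- Multiplication by the coordinate function `z` on `L²(𝕋)`. -/
def mulZ : L2T →L[ℂ] L2T :=
  (ContinuousLinearMap.mul ℂ ℂ).holderL (haarAddCircle : Measure UnitAddCircle) ∞ 2 2
    (fourierLp ∞ 1)

theorem mulZ_coeFn (f : L2T) :
    (mulZ f : UnitAddCircle → ℂ) =ᵐ[haarAddCircle] fun x => (toCircle x : ℂ) * f x := by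
  have h1 := (ContinuousLinearMap.mul ℂ ℂ).coeFn_holder (r := 2)
    (fourierLp (T := 1) ∞ 1) f
  have h2 := coeFn_fourierLp (T := 1) ∞ 1
  filter_upwards [h1, h2] with x hx1 hx2
  change ((ContinuousLinearMap.mul ℂ ℂ).holder 2 (fourierLp (T := 1) ∞ 1) f) x = _
  rw [hx1, hx2]
  simp

theorem fourierCoeff_toCircle_mul (f : UnitAddCircle → ℂ) (n : ℤ) :
    fourierCoeff (fun x => (toCircle x : ℂ) * f x) n = fourierCoeff f (n - 1) := by
  unfold fourierCoeff
  refine integral_congr_ae (Filter.Eventually.of_forall fun x => ?_)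
  have h : -(n - 1) = -n + 1 := by ring
  simp only [h, fourier_add, fourier_one, smul_eq_mul]
  ring

theorem mulZ_mem_H2 (f : H2) : mulZ f ∈ H2 := by
  intro n hn
  rw [fourierCoeff_congr_ae (mulZ_coeFn f), fourierCoeff_toCircle_mul]
  exact f.2 (n - 1) (by omega)

/-- `T_z` on `H²`, the operator of multiplication by `z`. -/
def shiftH2 : H2 →L[ℂ] H2 := (mulZ.comp H2.subtypeL).codRestrict H2 mulZ_mem_H2

/-- The value at the point `e^{2πix}` of a rational function (all its poles on the circle form a
finite set, which is a null set). -/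
def circleEval (ω : RatFunc ℂ) (x : UnitAddCircle) : ℂ :=
  RatFunc.eval (RingHom.id ℂ) (toCircle x : ℂ) ω

/-- `ρ ∈ Rat₀(𝕋)`: the rational function `ρ` is strictly proper and all its poles lie on the
unit circle. -/
structure IsRatZeroT (ρ : RatFunc ℂ) : Prop where
  poles : ∀ a : ℂ, ρ.denom.IsRoot a → ‖a‖ = 1
  strictlyProper : ρ.num.degree < ρ.denom.degree

theorem ae_eval_ne_zero {p : Polynomial ℂ} (hp : p ≠ 0) :
    ∀ᵐ x : UnitAddCircle ∂haarAddCircle, p.eval (toCircle x : ℂ) ≠ 0 := by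
  have hfin : {x : UnitAddCircle | p.eval (toCircle x : ℂ) = 0}.Finite := by
    have hinj : Function.Injective fun x : UnitAddCircle => (toCircle x : ℂ) :=
      fun x y h => AddCircle.injective_toCircle one_ne_zero (Subtype.ext h)
    refine Set.Finite.subset (Set.Finite.preimage hinj.injOn p.roots.toFinset.finite_toSet) ?_
    intro x hx
    simpa [hp] using hx
  have h0 : (haarAddCircle : Measure UnitAddCircle) {x | p.eval (toCircle x : ℂ) = 0} = 0 := by
    have : NullSingletonClass (volume : Measure UnitAddCircle) := ⟨fun x => by
      rw [← Metric.closedBall_zero, AddCircle.volume_closedBall]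
      simp⟩
    have h1 := hfin.measure_zero (volume : Measure UnitAddCircle)
    simpa [volume_eq_smul_haarAddCircle] using h1
  rw [ae_iff]
  simpa using h0

theorem circleEval_mul_denom (ω : RatFunc ℂ) :
    ∀ᵐ x : UnitAddCircle ∂haarAddCircle,
      circleEval ω x * ω.denom.eval (toCircle x : ℂ) = ω.num.eval (toCircle x : ℂ) := by
  filter_upwards [ae_eval_ne_zero ω.denom_ne_zero] with x hx
  unfold circleEval RatFunc.eval
  simp only [Polynomial.eval₂_id]
  field_simp

theorem circleEval_add (ω ρ : RatFunc ℂ) :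
    ∀ᵐ x : UnitAddCircle ∂haarAddCircle,
      circleEval (ω + ρ) x = circleEval ω x + circleEval ρ x := by
  filter_upwards [ae_eval_ne_zero ω.denom_ne_zero, ae_eval_ne_zero ρ.denom_ne_zero] with x h1 h2
  exact RatFunc.eval_add _ _ h1 h2

theorem circleEval_C_mul (c : ℂ) (ρ : RatFunc ℂ) :
    ∀ᵐ x : UnitAddCircle ∂haarAddCircle,
      circleEval (RatFunc.C c * ρ) x = c * circleEval ρ x := by
  filter_upwards [ae_eval_ne_zero ρ.denom_ne_zero] with x h2
  unfold circleEval
  rw [RatFunc.eval_mul _ _ (by simp) h2]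
  simp

theorem IsRatZeroT.zero : IsRatZeroT 0 :=
  ⟨by simp, by simp⟩

theorem IsRatZeroT.add {ρ σ : RatFunc ℂ} (hρ : IsRatZeroT ρ) (hσ : IsRatZeroT σ) :
    IsRatZeroT (ρ + σ) := by
  constructor
  · intro a ha
    have h := Polynomial.IsRoot.dvd ha (RatFunc.denom_add_dvd ρ σ)
    rcases Polynomial.root_mul.1 h with h | h
    · exact hρ.poles a h
    · exact hσ.poles a h
  · have h := RatFunc.num_denom_add ρ σ
    have d1 : ρ.denom.degree ≠ ⊥ := by simp [ρ.denom_ne_zero]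
    have d2 : σ.denom.degree ≠ ⊥ := by simp [σ.denom_ne_zero]
    have h1 : (ρ.num * σ.denom + ρ.denom * σ.num).degree < (ρ.denom * σ.denom).degree := by
      refine lt_of_le_of_lt (Polynomial.degree_add_le _ _) (max_lt ?_ ?_)
      · rw [Polynomial.degree_mul, Polynomial.degree_mul]
        exact WithBot.add_lt_add_right d2 hρ.strictlyProper
      · rw [Polynomial.degree_mul, Polynomial.degree_mul]
        exact WithBot.add_lt_add_left d1 hσ.strictlyProper
    have h2 := congrArg Polynomial.degree h
    rw [Polynomial.degree_mul, Polynomial.degree_mul (q := (ρ + σ).denom)] at h2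
    have d3 : (ρ + σ).denom.degree ≠ ⊥ := by simp [(ρ + σ).denom_ne_zero]
    have h3 := WithBot.add_lt_add_right d3 h1
    rw [← h2, add_comm _ (ρ + σ).denom.degree] at h3
    exact lt_of_add_lt_add_right h3

theorem IsRatZeroT.C_mul (c : ℂ) {ρ : RatFunc ℂ} (hρ : IsRatZeroT ρ) :
    IsRatZeroT (RatFunc.C c * ρ) := by
  by_cases hc : c = 0
  · subst hc
    simpa using IsRatZeroT.zero
  constructor
  · intro a ha
    have h := Polynomial.IsRoot.dvd ha (RatFunc.denom_mul_dvd (RatFunc.C c) ρ)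
    simp only [RatFunc.denom_C, one_mul] at h
    exact hρ.poles a h
  · have h := RatFunc.num_denom_mul (RatFunc.C c) ρ
    have h2 := congrArg Polynomial.degree h
    simp only [RatFunc.denom_C, one_mul, RatFunc.num_C, Polynomial.degree_mul,
      Polynomial.degree_C hc, zero_add] at h2
    have d3 : (RatFunc.C c * ρ).denom.degree ≠ ⊥ := by simp [(RatFunc.C c * ρ).denom_ne_zero]
    have h3 := WithBot.add_lt_add_right d3 hρ.strictlyProper
    rw [← h2, add_comm _ (RatFunc.C c * ρ).denom.degree] at h3
    exact lt_of_add_lt_add_right h3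

theorem eq_zero_of_abs_const_of_summable {a : ℕ → ℝ} (h : Summable a) (hc : ∀ n, a (n + 1) = a n) :
    ∀ n, a n = 0 := by
  have h0 : ∀ n, a n = a 0 := fun n => by
    induction n with
    | zero => rfl
    | succ k ih => rw [hc, ih]
  have h1 := h.tendsto_atTop_zero
  have h2 : a = fun _ => a 0 := funext h0
  rw [h2] at h1
  have h3 := tendsto_nhds_unique h1 tendsto_const_nhds
  intro n
  rw [h0, ← h3]

/-- A simple pole on the circle is not square integrable. -/
theorem const_eq_zero_of_memLp {k : UnitAddCircle → ℂ} (hk : MemLp k 2 haarAddCircle) {a c : ℂ}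
    (ha : ‖a‖ = 1)
    (h : ∀ᵐ x : UnitAddCircle ∂haarAddCircle, ((toCircle x : ℂ) - a) * k x = c) : c = 0 := by
  have hI : Integrable k haarAddCircle := hk.integrable (by norm_num)
  have hzI : Integrable (fun x : UnitAddCircle => (toCircle x : ℂ) * k x) haarAddCircle := by
    refine hI.bdd_mul (c := 1) ?_ (Filter.Eventually.of_forall fun x => by rw [Circle.norm_coe])
    exact (continuous_subtype_val.comp AddCircle.continuous_toCircle).aestronglyMeasurable
  have hrec : ∀ n : ℤ, fourierCoeff k (n - 1) = a * fourierCoeff k n + if n = 0 then c else 0 := by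
    intro n
    rw [← fourierCoeff_toCircle_mul]
    have e : (fun x : UnitAddCircle => (toCircle x : ℂ) * k x) =ᵐ[haarAddCircle]
        (fun x => a * k x) + fun x => c * fourier 0 x := by
      filter_upwards [h] with x hx
      simp only [Pi.add_apply, fourier_zero, mul_one]
      rw [← hx]
      ring
    rw [fourierCoeff_congr_ae e, fourierCoeff.add (hI.const_mul a)
      (((fourier 0).continuous.integrable_of_hasCompactSupport
        (HasCompactSupport.of_compactSpace _)).const_mul c), Pi.add_apply, fourierCoeff.const_mul,
      fourierCoeff.const_mul, fourierCoeff_fourier]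
    simp [Pi.single_apply]
  have hs : Summable fun n : ℤ => ‖fourierCoeff k n‖ ^ 2 := by
    have := (hasSum_sq_fourierCoeff (hk.toLp k)).summable
    simpa only [fourierCoeff_congr_ae hk.coeFn_toLp] using this
  have hp : ∀ n : ℕ, ‖fourierCoeff k (n : ℤ)‖ ^ 2 = 0 := by
    refine eq_zero_of_abs_const_of_summable (hs.comp_injective Nat.cast_injective) fun n => ?_
    have := hrec ((n : ℤ) + 1)
    rw [if_neg (by omega)] at this
    simp only [add_sub_cancel_right, add_zero] at this
    simp only [this, norm_mul, ha, one_mul, Nat.cast_add, Nat.cast_one]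
  have hm : ∀ n : ℕ, ‖fourierCoeff k (-1 - (n : ℤ))‖ ^ 2 = 0 := by
    refine eq_zero_of_abs_const_of_summable
      (hs.comp_injective (i := fun n : ℕ => -1 - (n : ℤ)) fun m n hmn => by
        simpa using hmn) fun n => ?_
    have := hrec (-1 - (n : ℤ))
    rw [if_neg (by omega), add_zero] at this
    have e : -1 - ((n + 1 : ℕ) : ℤ) = -1 - (n : ℤ) - 1 := by push_cast; ring
    simp only [e, this, norm_mul, ha, one_mul]
  have h0 := hrec 0
  have e1 : fourierCoeff k 0 = 0 := by simpa using hp 0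
  have e2 : fourierCoeff k (-1) = 0 := by simpa using hm 0
  simpa [e1, e2] using h0.symm

theorem dvd_of_memLp (d : ℕ) : ∀ (q p : Polynomial ℂ) (f : UnitAddCircle → ℂ), q ≠ 0 →
    q.natDegree = d → (∀ a : ℂ, q.IsRoot a → ‖a‖ = 1) → MemLp f 2 haarAddCircle →
    (∀ᵐ x : UnitAddCircle ∂haarAddCircle,
      f x * q.eval (toCircle x : ℂ) = p.eval (toCircle x : ℂ)) → q ∣ p := by
  have hbd : ∀ (r : Polynomial ℂ) (f : UnitAddCircle → ℂ), MemLp f 2 haarAddCircle →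
      MemLp (fun x => f x * r.eval (toCircle x : ℂ)) 2 haarAddCircle := by
    intro r f hf
    have hc : Continuous fun x : UnitAddCircle => r.eval (toCircle x : ℂ) :=
      r.continuous.comp (continuous_subtype_val.comp AddCircle.continuous_toCircle)
    have h1 : MemLp (fun x : UnitAddCircle => r.eval (toCircle x : ℂ)) ∞ haarAddCircle :=
      hc.memLp_of_hasCompactSupport (HasCompactSupport.of_compactSpace _)
    exact MemLp.mul' h1 hf
  induction d with
  | zero =>
    intro q p f hq hd _ _ _
    have hu : IsUnit q := by
      rw [Polynomial.isUnit_iff_degree_eq_zero, Polynomial.degree_eq_natDegree hq, hd]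
      rfl
    exact hu.dvd
  | succ d ih =>
    intro q p f hq hd hroot hf h
    obtain ⟨a, ha⟩ := IsAlgClosed.exists_root q (by
      rw [Polynomial.degree_eq_natDegree hq, hd]
      exact_mod_cast Nat.succ_ne_zero d)
    obtain ⟨q', rfl⟩ := Polynomial.dvd_iff_isRoot.2 ha
    have hq' : q' ≠ 0 := right_ne_zero_of_mul hq
    have hna : ‖a‖ = 1 := hroot a ha
    have hpa : p.eval a = 0 := by
      obtain ⟨r, hr⟩ := Polynomial.X_sub_C_dvd_sub_C_eval (a := a) (p := p)
      have hr1 : MemLp (fun x : UnitAddCircle => r.eval (toCircle x : ℂ)) 2 haarAddCircle := by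
        simpa using hbd r (fun _ => 1) (memLp_const 1)
      refine const_eq_zero_of_memLp (k := fun x => f x * q'.eval (toCircle x : ℂ) -
        r.eval (toCircle x : ℂ)) ((hbd q' f hf).sub hr1) hna ?_
      filter_upwards [h] with x hx
      have hr2 := congrArg (Polynomial.eval (toCircle x : ℂ)) hr
      simp only [Polynomial.eval_sub, Polynomial.eval_C, Polynomial.eval_mul,
        Polynomial.eval_X] at hr2 hx
      linear_combination hx + hr2
    obtain ⟨p', rfl⟩ := Polynomial.dvd_iff_isRoot.2 hpa
    refine mul_dvd_mul_left _ (ih q' p' f hq' ?_ ?_ hf ?_)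
    · rw [Polynomial.natDegree_mul (Polynomial.X_sub_C_ne_zero a) hq',
        Polynomial.natDegree_X_sub_C] at hd
      omega
    · intro b hb
      exact hroot b (by simp only [Polynomial.IsRoot.def] at hb ⊢; simp [hb])
    · filter_upwards [h, ae_eval_ne_zero (Polynomial.X_sub_C_ne_zero a)] with x hx hx0
      simp only [Polynomial.eval_mul] at hx
      refine mul_left_cancel₀ hx0 ?_
      linear_combination hx

/-- `L²(𝕋) ∩ Rat₀(𝕋) = {0}`. -/
theorem IsRatZeroT.eq_zero {ρ : RatFunc ℂ} (hρ : IsRatZeroT ρ) (f : L2T)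
    (h : ∀ᵐ x : UnitAddCircle ∂haarAddCircle, f x = circleEval ρ x) : ρ = 0 := by
  have hdvd : ρ.denom ∣ ρ.num := by
    refine dvd_of_memLp _ ρ.denom ρ.num f ρ.denom_ne_zero rfl hρ.poles (Lp.memLp f) ?_
    filter_upwards [h, circleEval_mul_denom ρ] with x h1 h2
    rw [h1, h2]
  exact RatFunc.num_eq_zero_iff.1 (Polynomial.eq_zero_of_dvd_of_degree_lt hdvd hρ.strictlyProper)

/-- The graph of `T_ω`: the pairs `(g, ℙ f)` with `g ∈ H²`, `f ∈ L²` and `ω g = f + ρ` on the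
circle for some `ρ ∈ Rat₀(𝕋)`. -/
def toeplitzGraph (ω : RatFunc ℂ) : Submodule ℂ (H2 × H2) where
  carrier := {gh | ∃ (f : L2T) (ρ : RatFunc ℂ), IsRatZeroT ρ ∧
    (∀ᵐ x : UnitAddCircle ∂haarAddCircle,
      circleEval ω x * (gh.1 : L2T) x = f x + circleEval ρ x) ∧
    gh.2 = rieszProj f}
  zero_mem' := by
    refine ⟨0, 0, IsRatZeroT.zero, ?_, by simp⟩
    exact Filter.Eventually.of_forall fun x => by simp [circleEval]
  add_mem' := by
    rintro ⟨g₁, h₁⟩ ⟨g₂, h₂⟩ ⟨f₁, ρ₁, hρ₁, e₁, rfl⟩ ⟨f₂, ρ₂, hρ₂, e₂, rfl⟩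
    refine ⟨f₁ + f₂, ρ₁ + ρ₂, hρ₁.add hρ₂, ?_, by simp⟩
    filter_upwards [e₁, e₂, circleEval_add ρ₁ ρ₂, Lp.coeFn_add f₁ f₂,
      Lp.coeFn_add (g₁ : L2T) (g₂ : L2T)] with x a₁ a₂ a₃ a₄ a₅
    simp only [Prod.fst_add, Submodule.coe_add] at a₁ a₂ ⊢
    rw [a₃, a₄, a₅]
    simp only [Pi.add_apply]
    linear_combination a₁ + a₂
  smul_mem' := by
    rintro c ⟨g, h⟩ ⟨f, ρ, hρ, e, rfl⟩
    refine ⟨c • f, RatFunc.C c * ρ, hρ.C_mul c, ?_, by simp⟩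
    filter_upwards [e, circleEval_C_mul c ρ, Lp.coeFn_smul c f,
      Lp.coeFn_smul c (g : L2T)] with x a₁ a₃ a₄ a₅
    simp only [Prod.smul_fst, Submodule.coe_smul] at a₁ ⊢
    rw [a₃, a₄, a₅]
    simp only [Pi.smul_apply, smul_eq_mul]
    linear_combination c * a₁

theorem toeplitzGraph_single_valued (ω : RatFunc ℂ) (y : H2 × H2) (hy : y ∈ toeplitzGraph ω)
    (hy0 : y.1 = 0) : y.2 = 0 := by
  obtain ⟨f, ρ, hρ, e, h2⟩ := hy
  have hρ0 : RatFunc.C (-1) * ρ = 0 := by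
    refine (hρ.C_mul (-1)).eq_zero f ?_
    filter_upwards [e, circleEval_C_mul (-1) ρ,
      Lp.coeFn_zero ℂ 2 (haarAddCircle : Measure UnitAddCircle)] with x a₁ a₂ a₃
    rw [a₂]
    rw [hy0, Submodule.coe_zero, a₃] at a₁
    simp only [Pi.zero_apply, mul_zero] at a₁
    linear_combination -a₁
  have hρ1 : ρ = 0 := by simpa using hρ0
  have hf : f = 0 := by
    rw [Lp.eq_zero_iff_ae_eq_zero]
    filter_upwards [e, Lp.coeFn_zero ℂ 2 (haarAddCircle : Measure UnitAddCircle)] with x a₁ a₃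
    rw [hy0, Submodule.coe_zero, a₃, hρ1] at a₁
    simpa [circleEval] using a₁.symm
  rw [h2, hf, map_zero]

/-- The Toeplitz-like operator `T_ω (H² → H²)`:
`Dom(T_ω) = {g ∈ H² : ω g = f + ρ with f ∈ L², ρ ∈ Rat₀(𝕋)}` and `T_ω g = ℙ f`. -/
def toeplitz (ω : RatFunc ℂ) : H2 →ₗ.[ℂ] H2 := (toeplitzGraph ω).toLinearPMap

theorem toeplitz_graph (ω : RatFunc ℂ) : (toeplitz ω).graph = toeplitzGraph ω :=
  Submodule.toLinearPMap_graph_eq _ fun y hy hy0 => toeplitzGraph_single_valued ω y hy hy0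

/-- The composition `T A` of an unbounded operator `T` and a bounded operator `A`, on its maximal
domain `{f : A f ∈ Dom(T)}`. -/
def pmapCompCLM (T : H2 →ₗ.[ℂ] H2) (A : H2 →L[ℂ] H2) : H2 →ₗ.[ℂ] H2 where
  domain := T.domain.comap (A : H2 →ₗ[ℂ] H2)
  toFun := T.toFun ∘ₗ (A : H2 →ₗ[ℂ] H2).restrict fun _ hf => hf

/-- Sarason-Toeplitz operators on `H²`: closed, densely defined operators which satisfy Sarason's
three algebraic axioms. The equality in `adjoint_comp_comp` is one of unbounded operators, so it
includes the equality of the domains; `fourierCoeff f 0` is the value `f(0)`. -/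
structure IsSarasonToeplitz (T : H2 →ₗ.[ℂ] H2) : Prop where
  closed : T.IsClosed
  dense_domain : Dense (T.domain : Set H2)
  shift_mem : ∀ f ∈ T.domain, shiftH2 f ∈ T.domain
  adjoint_comp_comp :
    (ContinuousLinearMap.adjoint shiftH2 : H2 →ₗ[ℂ] H2).compPMap (pmapCompCLM T shiftH2) = T
  backward_mem : ∀ f ∈ T.domain, fourierCoeff (f : L2T) 0 = 0 →
    ContinuousLinearMap.adjoint shiftH2 f ∈ T.domain

end

/-!
Let `ω = p / q` in lowest terms. Partial fractions split every rational function into a part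
without poles on `𝕋`, which multiplies `L²(𝕋)` into itself, and a part in `Rat₀(𝕋)`. Hence
`L²(𝕋) + Rat₀(𝕋)` is stable under multiplication by rational functions without poles on `𝕋`; this
puts `z g` into `Dom(T_ω)` for `g ∈ Dom(T_ω)`. Splitting `ω` itself puts the constants into the
domain, which therefore contains the polynomials and is dense. Writing `ρ ∈ Rat₀(𝕋)` as `c + z σ`
and dividing `ω z g = f + ρ` by `z` shows that `T_ω (z g) = h` implies `T_ω g = T_z^* h`; axioms 2
and 3 follow.

For closedness, consider the continuous map `Φ (g, h) = p g - q h`. If `Φ (g, h) = 0`, then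
`ω g = h` and `(g, h)` is in the graph of `T_ω`. If `ω g = f + ρ` and `h = ℙ f`, then
`Φ (g, h) = q ρ + q (f - ℙ f)`, which is in `H²` and has no Fourier coefficients of index `≥ deg q`:
`q ρ` is square integrable, hence a polynomial of degree `< deg q`. So the graph is the preimage
under `Φ` of a finite-dimensional space.
-/

open Polynomial

section FourierCoefficients

variable {T : ℝ} [Fact (0 < T)]

theorem fourierCoeff_eq_inner_fourierBasis (f : Lp ℂ 2 (@haarAddCircle T _)) (n : ℤ) :
    fourierCoeff f n = inner ℂ (fourierBasis n) f := by
  rw [← fourierBasis_repr, HilbertBasis.repr_apply_apply]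

theorem fourierCoeff_Lp_add (f g : Lp ℂ 2 (@haarAddCircle T _)) (n : ℤ) :
    fourierCoeff (f + g : Lp ℂ 2 _) n = fourierCoeff f n + fourierCoeff g n := by
  simp only [fourierCoeff_eq_inner_fourierBasis, inner_add_right]

theorem fourierCoeff_Lp_sub (f g : Lp ℂ 2 (@haarAddCircle T _)) (n : ℤ) :
    fourierCoeff (f - g : Lp ℂ 2 _) n = fourierCoeff f n - fourierCoeff g n := by
  simp only [fourierCoeff_eq_inner_fourierBasis, inner_sub_right]

theorem fourierCoeff_Lp_smul (c : ℂ) (f : Lp ℂ 2 (@haarAddCircle T _)) (n : ℤ) :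
    fourierCoeff (c • f : Lp ℂ 2 _) n = c * fourierCoeff f n := by
  simp only [fourierCoeff_eq_inner_fourierBasis, inner_smul_right]

theorem fourierCoeff_Lp_sum {ι : Type*} (s : Finset ι) (f : ι → Lp ℂ 2 (@haarAddCircle T _))
    (n : ℤ) : fourierCoeff (∑ i ∈ s, f i : Lp ℂ 2 _) n = ∑ i ∈ s, fourierCoeff (f i) n := by
  simp only [fourierCoeff_eq_inner_fourierBasis, inner_sum]

theorem Lp_ext_fourierCoeff {f g : Lp ℂ 2 (@haarAddCircle T _)}
    (h : ∀ n, fourierCoeff f n = fourierCoeff g n) : f = g :=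
  fourierBasis.repr.injective <| lp.ext <| funext fun n => by
    simpa only [fourierBasis_repr] using h n

theorem fourierCoeff_fourierBasis (m n : ℤ) :
    fourierCoeff (fourierBasis m : Lp ℂ 2 (@haarAddCircle T _)) n = if n = m then 1 else 0 := by
  rw [fourierCoeff_eq_inner_fourierBasis]
  exact orthonormal_iff_ite.1 fourierBasis.orthonormal n m

theorem fourierBasis_zero_coeFn :
    (fourierBasis 0 : Lp ℂ 2 (@haarAddCircle T _)) =ᵐ[haarAddCircle] fun _ => (1 : ℂ) := by
  rw [coe_fourierBasis]
  filter_upwards [coeFn_fourierLp (T := T) 2 0] with x hx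
  rw [hx, fourier_zero]

theorem mem_span_fourierBasis_of_fourierCoeff_eq_zero (s : Finset ℤ)
    {f : Lp ℂ 2 (@haarAddCircle T _)} (hf : ∀ n ∉ s, fourierCoeff f n = 0) :
    f ∈ Submodule.span ℂ (fourierBasis '' (s : Set ℤ)) := by
  have hsum : HasSum (fun n => fourierCoeff f n • fourierBasis n) f := by
    simpa only [fourierBasis_repr] using fourierBasis.hasSum_repr f
  rw [hsum.unique (hasSum_sum_of_ne_finset_zero fun n hn => by rw [hf n hn, zero_smul])]
  exact Submodule.sum_mem _ fun n hn =>
    Submodule.smul_mem _ _ (Submodule.subset_span (Set.mem_image_of_mem _ hn))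

end FourierCoefficients

section Shift

theorem H2_ext {f g : H2}
    (h : ∀ n : ℤ, 0 ≤ n → fourierCoeff (f : L2T) n = fourierCoeff (g : L2T) n) : f = g := by
  refine Subtype.ext (Lp_ext_fourierCoeff fun n => ?_)
  rcases lt_or_ge n 0 with hn | hn
  · rw [f.2 n hn, g.2 n hn]
  · exact h n hn

theorem fourierBasis_mem_H2 {n : ℤ} (hn : 0 ≤ n) : (fourierBasis n : L2T) ∈ H2 := by
  intro m hm
  rw [fourierCoeff_fourierBasis, if_neg (by lia)]

theorem dense_of_forall_fourierBasis_mem {S : Submodule ℂ H2}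
    (hS : ∀ n : ℕ, (⟨fourierBasis n, fourierBasis_mem_H2 n.cast_nonneg⟩ : H2) ∈ S) :
    Dense (S : Set H2) := by
  rw [Submodule.dense_iff_topologicalClosure_eq_top, Submodule.topologicalClosure_eq_top_iff,
    Submodule.eq_bot_iff]
  intro f hf
  refine H2_ext fun n hn => ?_
  lift n to ℕ using hn
  have horth := (Submodule.mem_orthogonal _ _).1 hf _ (hS n)
  rw [Submodule.coe_inner] at horth
  rw [fourierCoeff_eq_inner_fourierBasis, horth, fourierCoeff_eq_inner_fourierBasis,
    Submodule.coe_zero, inner_zero_right]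

theorem fourierCoeff_rieszProj (f : L2T) {n : ℤ} (hn : 0 ≤ n) :
    fourierCoeff (rieszProj f : L2T) n = fourierCoeff f n := by
  rw [fourierCoeff_eq_inner_fourierBasis, fourierCoeff_eq_inner_fourierBasis]
  exact Submodule.inner_orthogonalProjectionOnto_eq_of_mem_left
    (K := H2) ⟨_, fourierBasis_mem_H2 hn⟩ f

theorem rieszProj_coe (h : H2) : rieszProj (h : L2T) = h :=
  Submodule.orthogonalProjectionOnto_mem_subspace_eq_self h

theorem fourierCoeff_mulZ (f : L2T) (n : ℤ) :
    fourierCoeff (mulZ f) n = fourierCoeff f (n - 1) := by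
  rw [fourierCoeff_congr_ae (mulZ_coeFn f), fourierCoeff_toCircle_mul]

theorem mulZ_fourierBasis (n : ℤ) : mulZ (fourierBasis n) = fourierBasis (n + 1) := by
  refine Lp_ext_fourierCoeff fun m => ?_
  simp only [fourierCoeff_mulZ, fourierCoeff_fourierBasis, sub_eq_iff_eq_add]

theorem coe_shiftH2 (f : H2) : (shiftH2 f : L2T) = mulZ f := rfl

theorem fourierCoeff_adjoint_shiftH2 (f : H2) {n : ℤ} (hn : 0 ≤ n) :
    fourierCoeff (ContinuousLinearMap.adjoint shiftH2 f : L2T) n =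
      fourierCoeff (f : L2T) (n + 1) := by
  have hadj := ContinuousLinearMap.adjoint_inner_right shiftH2 ⟨_, fourierBasis_mem_H2 hn⟩ f
  rw [Submodule.coe_inner, Submodule.coe_inner, coe_shiftH2, mulZ_fourierBasis] at hadj
  rwa [fourierCoeff_eq_inner_fourierBasis, fourierCoeff_eq_inner_fourierBasis]

theorem shiftH2_adjoint_of_fourierCoeff_zero {f : H2} (hf : fourierCoeff (f : L2T) 0 = 0) :
    shiftH2 (ContinuousLinearMap.adjoint shiftH2 f) = f := by
  refine H2_ext fun n hn => ?_
  rw [coe_shiftH2, fourierCoeff_mulZ]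
  rcases hn.eq_or_lt with rfl | hn
  · rw [hf]
    exact (ContinuousLinearMap.adjoint shiftH2 f).2 _ (by norm_num)
  · rw [fourierCoeff_adjoint_shiftH2 _ (by lia), sub_add_cancel]

end Shift

section Multiplication

theorem exists_Lp_coeFn_eq_mul {α R : Type*} [TopologicalSpace α] [CompactSpace α]
    [MeasurableSpace α] [OpensMeasurableSpace α] {μ : Measure α} [IsFiniteMeasureOnCompacts μ]
    [NormedRing R] {p : ℝ≥0∞} {φ : α → R} (hφ : Continuous φ) (f : Lp R p μ) :
    ∃ g : Lp R p μ, g =ᵐ[μ] fun x => φ x * f x := by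
  have hφ_memLp : MemLp φ ∞ μ :=
    hφ.memLp_of_hasCompactSupport (HasCompactSupport.of_compactSpace _)
  have hmul : MemLp (fun x => φ x * f x) p μ := MemLp.mul' (Lp.memLp f) hφ_memLp
  exact ⟨hmul.toLp, hmul.coeFn_toLp⟩

theorem continuous_coe_toCircle : Continuous fun x : UnitAddCircle => (toCircle x : ℂ) :=
  continuous_subtype_val.comp AddCircle.continuous_toCircle

theorem mulZ_surjective : Function.Surjective mulZ := by
  intro f
  obtain ⟨g, hg⟩ := exists_Lp_coeFn_eq_mul (φ := fun x : UnitAddCircle => (toCircle x : ℂ)⁻¹)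
    (continuous_coe_toCircle.inv₀ fun x => Circle.coe_ne_zero _) f
  refine ⟨g, Lp.ext ?_⟩
  filter_upwards [mulZ_coeFn g, hg] with x hx hgx
  rw [hx, hgx]
  exact mul_inv_cancel_left₀ (Circle.coe_ne_zero _) _

theorem mulZ_pow_coeFn (k : ℕ) (f : L2T) :
    (mulZ ^ k) f =ᵐ[haarAddCircle] fun x => (toCircle x : ℂ) ^ k * f x := by
  induction k with
  | zero => simp
  | succ k ih =>
    filter_upwards [ih, mulZ_coeFn ((mulZ ^ k) f)] with x hpow hmul
    rw [pow_succ', mul_apply_eq_comp, hmul, hpow]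
    ring

theorem fourierCoeff_mulZ_pow (k : ℕ) (f : L2T) (n : ℤ) :
    fourierCoeff ((mulZ ^ k) f) n = fourierCoeff f (n - k) := by
  induction k generalizing n with
  | zero => simp
  | succ k ih =>
    rw [pow_succ', mul_apply_eq_comp, fourierCoeff_mulZ, ih, Nat.cast_succ, sub_sub, add_comm 1]

theorem aeval_mulZ_coeFn (p : ℂ[X]) (f : L2T) :
    aeval mulZ p f =ᵐ[haarAddCircle] fun x => p.eval (toCircle x : ℂ) * f x := by
  induction p using Polynomial.induction_on' with
  | add p q hp hq =>
    rw [map_add, add_apply]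
    filter_upwards [hp, hq, Lp.coeFn_add (aeval mulZ p f) (aeval mulZ q f)] with x hpx hqx hadd
    rw [hadd, Pi.add_apply, hpx, hqx, eval_add, add_mul]
  | monomial k a =>
    rw [aeval_monomial, ← Algebra.smul_def, smul_apply]
    filter_upwards [mulZ_pow_coeFn k f, Lp.coeFn_smul a ((mulZ ^ k) f)] with x hpow hsmul
    rw [hsmul, Pi.smul_apply, hpow, eval_monomial, smul_eq_mul, mul_assoc]

theorem fourierCoeff_aeval_mulZ (p : ℂ[X]) (f : L2T) (n : ℤ) :
    fourierCoeff (aeval mulZ p f) n =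
      ∑ k ∈ Finset.range (p.natDegree + 1), p.coeff k * fourierCoeff f (n - k) := by
  simp only [aeval_eq_sum_range, sum_apply, smul_apply, fourierCoeff_Lp_sum, fourierCoeff_Lp_smul,
    fourierCoeff_mulZ_pow]

theorem aeval_mulZ_mem_H2 (p : ℂ[X]) (f : H2) : aeval mulZ p (f : L2T) ∈ H2 := by
  intro n hn
  rw [fourierCoeff_aeval_mulZ]
  exact Finset.sum_eq_zero fun k _ => by rw [f.2 _ (by lia), mul_zero]

theorem fourierCoeff_aeval_mulZ_eq_zero {p : ℂ[X]} {f : L2T}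
    (hf : ∀ n : ℤ, 0 ≤ n → fourierCoeff f n = 0) {n : ℤ} (hn : p.natDegree ≤ n) :
    fourierCoeff (aeval mulZ p f) n = 0 := by
  rw [fourierCoeff_aeval_mulZ]
  refine Finset.sum_eq_zero fun k hk => ?_
  have hk_le := Finset.mem_range_succ_iff.1 hk
  rw [hf _ (by lia), mul_zero]

theorem fourierCoeff_aeval_mulZ_fourierBasis_zero_eq_zero {p : ℂ[X]} {n : ℕ} (hn : p.degree < n) :
    fourierCoeff (aeval mulZ p (fourierBasis 0 : L2T)) n = 0 := by
  rw [fourierCoeff_aeval_mulZ]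
  refine Finset.sum_eq_zero fun k _ => ?_
  rw [fourierCoeff_fourierBasis]
  split_ifs with hk
  · obtain rfl : n = k := by lia
    rw [coeff_eq_zero_of_degree_lt hn, zero_mul]
  · exact mul_zero _

end Multiplication

section RationalFunctions

theorem degree_lt_degree_of_mul_eq_mul {R : Type*} [Semiring R] [NoZeroDivisors R]
    {p q r s : R[X]} (h : p * q = r * s) (hs : s ≠ 0) (hrq : r.degree < q.degree) :
    p.degree < s.degree := by
  have hdeg := congrArg degree h
  rw [degree_mul, degree_mul] at hdeg
  refine lt_of_add_lt_add_right (a := q.degree) ?_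
  rw [hdeg, add_comm s.degree]
  exact WithBot.add_lt_add_right (degree_ne_bot.2 hs) hrq

theorem exists_monic_mul_eq_of_monic {K : Type*} [Field K] [IsAlgClosed K] {q : K[X]}
    (hq : q.Monic) (P : K → Prop) :
    ∃ q₀ q₁ : K[X], q₀.Monic ∧ q₁.Monic ∧ q₀ * q₁ = q ∧
      (∀ a, q₀.IsRoot a → ¬P a) ∧ ∀ a, q₁.IsRoot a → P a := by
  classical
  let f (s : Multiset K) : K[X] := (s.map fun a => X - C a).prod
  have hmonic (s : Multiset K) : (f s).Monic :=
    monic_multiset_prod_of_monic _ _ fun a _ => monic_X_sub_C a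
  have hroot {s : Multiset K} {a : K} (ha : (f s).IsRoot a) : a ∈ s := by
    rwa [← mem_roots (hmonic s).ne_zero, roots_multiset_prod_X_sub_C] at ha
  refine ⟨f (q.roots.filter fun a => ¬P a), f (q.roots.filter P), hmonic _, hmonic _, ?_,
    fun a ha => (Multiset.mem_filter.1 (hroot ha)).2,
    fun a ha => (Multiset.mem_filter.1 (hroot ha)).2⟩
  rw [← Multiset.prod_add, ← Multiset.map_add, add_comm, Multiset.filter_add_not]
  exact ((IsAlgClosed.splits q).eq_prod_roots_of_monic hq).symm

theorem circleEval_mul (ω ρ : RatFunc ℂ) :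
    ∀ᵐ x : UnitAddCircle ∂haarAddCircle,
      circleEval (ω * ρ) x = circleEval ω x * circleEval ρ x := by
  filter_upwards [ae_eval_ne_zero ω.denom_ne_zero, ae_eval_ne_zero ρ.denom_ne_zero] with x hω hρ
  exact RatFunc.eval_mul _ _ hω hρ

theorem circleEval_zero (x : UnitAddCircle) : circleEval 0 x = 0 := RatFunc.eval_zero _ _

theorem circleEval_C (c : ℂ) (x : UnitAddCircle) : circleEval (RatFunc.C c) x = c :=
  RatFunc.eval_C _ _

theorem circleEval_X (x : UnitAddCircle) : circleEval RatFunc.X x = toCircle x :=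
  RatFunc.eval_X _ _

theorem circleEval_algebraMap (p : ℂ[X]) (x : UnitAddCircle) :
    circleEval (algebraMap ℂ[X] (RatFunc ℂ) p) x = p.eval (toCircle x : ℂ) := by
  simp [circleEval, RatFunc.eval_algebraMap]

theorem IsRatZeroT.of_div {r s : ℂ[X]} (hs : ∀ a, s.IsRoot a → ‖a‖ = 1)
    (hdeg : r.degree < s.degree) :
    IsRatZeroT (algebraMap ℂ[X] (RatFunc ℂ) r / algebraMap ℂ[X] (RatFunc ℂ) s) where
  poles a ha := hs a (ha.dvd (RatFunc.denom_div_dvd r s))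
  strictlyProper := degree_lt_degree_of_mul_eq_mul
    ((RatFunc.num_mul_eq_mul_denom_iff (ne_zero_of_degree_gt hdeg)).2 rfl)
    (RatFunc.denom_ne_zero _) hdeg

theorem IsRatZeroT.exists_eq_C_add_X_mul {ρ : RatFunc ℂ} (hρ : IsRatZeroT ρ) :
    ∃ (c : ℂ) (σ : RatFunc ℂ), IsRatZeroT σ ∧ ρ = RatFunc.C c + RatFunc.X * σ := by
  set r := ρ.num
  set s := ρ.denom
  have hs0 : s.coeff 0 ≠ 0 := fun h => by
    simpa using hρ.poles 0 (by rwa [IsRoot.def, ← coeff_zero_eq_eval_zero])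
  set c := r.coeff 0 / s.coeff 0
  set t := (r - C c * s).divX
  have hsplit : X * t = r - C c * s := by
    have hcoeff : (r - C c * s).coeff 0 = 0 := by
      rw [coeff_sub, coeff_C_mul, div_mul_cancel₀ _ hs0, sub_self]
    rw [mul_comm]
    simpa only [hcoeff, C_0, add_zero] using divX_mul_X_add (r - C c * s)
  have hdeg : t.degree < s.degree := by
    rcases eq_or_ne (r - C c * s) 0 with hzero | hne
    · rw [show t = 0 by simp only [t, hzero, divX_zero], degree_zero]
      exact bot_lt_iff_ne_bot.2 (degree_ne_bot.2 ρ.denom_ne_zero)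
    · refine (degree_divX_lt hne).trans_le ((degree_sub_le _ _).trans ?_)
      exact max_le hρ.strictlyProper.le (smul_eq_C_mul (p := s) c ▸ degree_smul_le c s)
  refine ⟨c, _, .of_div hρ.poles hdeg, ?_⟩
  have hs : algebraMap ℂ[X] (RatFunc ℂ) s ≠ 0 := RatFunc.algebraMap_ne_zero ρ.denom_ne_zero
  have hmap := congrArg (algebraMap ℂ[X] (RatFunc ℂ)) hsplit
  simp only [map_mul, map_sub, RatFunc.algebraMap_X, RatFunc.algebraMap_C] at hmap
  rw [← mul_div_assoc, hmap, sub_div, mul_div_cancel_right₀ _ hs, add_sub_cancel,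
    RatFunc.num_div_denom]

/-- The rational functions without poles on the unit circle, whose values on the circle are
multipliers of `L²(𝕋)`. -/
def IsPoleFreeOnT (φ : RatFunc ℂ) : Prop := ∀ a : ℂ, φ.denom.IsRoot a → ‖a‖ ≠ 1

theorem IsPoleFreeOnT.continuous_circleEval {φ : RatFunc ℂ} (hφ : IsPoleFreeOnT φ) :
    Continuous (circleEval φ) := by
  change Continuous fun x : UnitAddCircle =>
    φ.num.eval (toCircle x : ℂ) / φ.denom.eval (toCircle x : ℂ)
  exact (φ.num.continuous.comp continuous_coe_toCircle).div
    (φ.denom.continuous.comp continuous_coe_toCircle)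
    fun x hx => hφ _ hx (Circle.norm_coe _)

theorem IsPoleFreeOnT.exists_Lp_coeFn_eq_circleEval {φ : RatFunc ℂ} (hφ : IsPoleFreeOnT φ) :
    ∃ u : L2T, u =ᵐ[haarAddCircle] circleEval φ := by
  obtain ⟨u, hu⟩ := exists_Lp_coeFn_eq_mul hφ.continuous_circleEval (fourierBasis 0 : L2T)
  refine ⟨u, ?_⟩
  filter_upwards [hu, fourierBasis_zero_coeFn] with x hux hone
  rw [hux, hone, mul_one]

theorem IsPoleFreeOnT.X : IsPoleFreeOnT RatFunc.X := by
  simp [IsPoleFreeOnT]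

theorem exists_eq_isPoleFreeOnT_add_isRatZeroT (ω : RatFunc ℂ) :
    ∃ φ ρ : RatFunc ℂ, IsPoleFreeOnT φ ∧ IsRatZeroT ρ ∧ ω = φ + ρ := by
  obtain ⟨q₀, q₁, hq₀, hq₁, hq, hroot₀, hroot₁⟩ :=
    exists_monic_mul_eq_of_monic ω.monic_denom (‖·‖ = 1)
  have hcop : IsCoprime q₀ q₁ := by
    rw [isCoprime_iff_aeval_ne_zero_of_isAlgClosed ℂ ℂ]
    intro a
    by_contra! ha
    exact hroot₀ a ha.1 (hroot₁ a ha.2)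
  obtain ⟨p, r₀, r₁, -, hr₁, hsplit⟩ :=
    Polynomial.div_eq_quo_add_rem_div_add_rem_div (RatFunc ℂ) ω.num hq₀ hq₁ hcop
  refine ⟨algebraMap ℂ[X] (RatFunc ℂ) (p * q₀ + r₀) / algebraMap ℂ[X] (RatFunc ℂ) q₀, _,
    fun a ha => hroot₀ a (ha.dvd (RatFunc.denom_div_dvd _ _)), .of_div hroot₁ hr₁, ?_⟩
  have hq₀' : algebraMap ℂ[X] (RatFunc ℂ) q₀ ≠ 0 := RatFunc.algebraMap_ne_zero hq₀.ne_zero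
  rw [map_add, map_mul, add_div, mul_div_cancel_right₀ _ hq₀', ← hsplit, ← map_mul, hq,
    RatFunc.num_div_denom]

theorem IsRatZeroT.exists_algebraMap_mul_eq {ρ : RatFunc ℂ} (hρ : IsRatZeroT ρ) {q : ℂ[X]}
    (hq : q ≠ 0) (u : L2T)
    (hu : u =ᵐ[haarAddCircle] fun x => q.eval (toCircle x : ℂ) * circleEval ρ x) :
    ∃ t : ℂ[X], t.degree < q.degree ∧
      algebraMap ℂ[X] (RatFunc ℂ) q * ρ = algebraMap ℂ[X] (RatFunc ℂ) t := by
  obtain ⟨t, ht⟩ : ρ.denom ∣ q * ρ.num := by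
    refine dvd_of_memLp _ ρ.denom _ u ρ.denom_ne_zero rfl hρ.poles (Lp.memLp u) ?_
    filter_upwards [hu, circleEval_mul_denom ρ] with x hux hρx
    rw [hux, mul_assoc, hρx, eval_mul]
  refine ⟨t, degree_lt_degree_of_mul_eq_mul (q := ρ.denom) (r := ρ.num)
    (by rw [mul_comm t, ← ht, mul_comm]) hq hρ.strictlyProper, ?_⟩
  conv_lhs => rw [← RatFunc.num_div_denom ρ]
  rw [← mul_div_assoc, ← map_mul, ht, map_mul,
    mul_div_cancel_left₀ _ (RatFunc.algebraMap_ne_zero ρ.denom_ne_zero)]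

end RationalFunctions

section Domain

variable {ω : RatFunc ℂ}

theorem mem_toeplitz_domain {g : H2} :
    g ∈ (toeplitz ω).domain ↔ ∃ (f : L2T) (ρ : RatFunc ℂ), IsRatZeroT ρ ∧
      ∀ᵐ x : UnitAddCircle ∂haarAddCircle,
        circleEval ω x * (g : L2T) x = f x + circleEval ρ x := by
  rw [LinearPMap.mem_domain_iff, toeplitz_graph]
  exact ⟨fun ⟨_, f, ρ, hρ, h, _⟩ => ⟨f, ρ, hρ, h⟩, fun ⟨f, ρ, hρ, h⟩ => ⟨_, f, ρ, hρ, h, rfl⟩⟩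

theorem mem_toeplitz_domain_of_coeFn_eq_mul {φ : RatFunc ℂ} (hφ : IsPoleFreeOnT φ) {g g' : H2}
    (hg : g ∈ (toeplitz ω).domain)
    (hg' : (g' : L2T) =ᵐ[haarAddCircle] fun x => circleEval φ x * (g : L2T) x) :
    g' ∈ (toeplitz ω).domain := by
  obtain ⟨f, ρ, -, hf⟩ := mem_toeplitz_domain.1 hg
  obtain ⟨ψ, σ, hψ, hσ, hsplit⟩ := exists_eq_isPoleFreeOnT_add_isRatZeroT (φ * ρ)
  obtain ⟨u, hu⟩ := exists_Lp_coeFn_eq_mul hφ.continuous_circleEval f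
  obtain ⟨v, hv⟩ := hψ.exists_Lp_coeFn_eq_circleEval
  refine mem_toeplitz_domain.2 ⟨u + v, σ, hσ, ?_⟩
  filter_upwards [hf, hg', hu, hv, Lp.coeFn_add u v, circleEval_mul φ ρ, circleEval_add ψ σ]
    with x hfx hgx hux hvx huv hmul hadd
  rw [← hsplit, hmul] at hadd
  rw [huv, Pi.add_apply, hux, hvx, hgx]
  linear_combination circleEval φ x * hfx + hadd

theorem shiftH2_mem_toeplitz_domain {g : H2} (hg : g ∈ (toeplitz ω).domain) :
    shiftH2 g ∈ (toeplitz ω).domain := by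
  refine mem_toeplitz_domain_of_coeFn_eq_mul .X hg ?_
  simpa only [circleEval_X, coe_shiftH2] using mulZ_coeFn (g : L2T)

theorem fourierBasis_mem_toeplitz_domain (n : ℕ) :
    (⟨fourierBasis n, fourierBasis_mem_H2 n.cast_nonneg⟩ : H2) ∈ (toeplitz ω).domain := by
  induction n with
  | zero =>
    obtain ⟨φ, ρ, hφ, hρ, rfl⟩ := exists_eq_isPoleFreeOnT_add_isRatZeroT ω
    obtain ⟨f, hf⟩ := hφ.exists_Lp_coeFn_eq_circleEval
    refine mem_toeplitz_domain.2 ⟨f, ρ, hρ, ?_⟩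
    filter_upwards [hf, fourierBasis_zero_coeFn, circleEval_add φ ρ] with x hfx hone hadd
    rw [Nat.cast_zero, hone, mul_one, hadd, hfx]
  | succ n ih =>
    convert shiftH2_mem_toeplitz_domain ih using 1
    exact Subtype.ext (mulZ_fourierBasis n).symm

theorem dense_toeplitz_domain (ω : RatFunc ℂ) : Dense ((toeplitz ω).domain : Set H2) :=
  dense_of_forall_fourierBasis_mem fourierBasis_mem_toeplitz_domain

end Domain

section SarasonAxioms

variable {ω : RatFunc ℂ}

theorem adjoint_shiftH2_mem_toeplitzGraph {g h : H2} (hgh : (shiftH2 g, h) ∈ toeplitzGraph ω) :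
    (g, ContinuousLinearMap.adjoint shiftH2 h) ∈ toeplitzGraph ω := by
  obtain ⟨f, ρ, hρ, hf, rfl⟩ := hgh
  obtain ⟨c, σ, hσ, rfl⟩ := hρ.exists_eq_C_add_X_mul
  obtain ⟨k, hk⟩ := mulZ_surjective (f + c • (fourierBasis 0 : L2T))
  refine ⟨k, σ, hσ, ?_, H2_ext fun n hn => ?_⟩
  · have hadd := Lp.coeFn_add f (c • (fourierBasis 0 : L2T))
    rw [← hk] at hadd
    filter_upwards [hf, hadd, mulZ_coeFn k, mulZ_coeFn (g : L2T), fourierBasis_zero_coeFn,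
      Lp.coeFn_smul c (fourierBasis 0 : L2T), circleEval_add (RatFunc.C c) (RatFunc.X * σ),
      circleEval_mul RatFunc.X σ] with x hfx haddx hkx hgx hone hsmul hCX hX
    rw [coe_shiftH2, hgx, hCX, hX, circleEval_C, circleEval_X] at hfx
    rw [hkx, Pi.add_apply, hsmul, Pi.smul_apply, hone, smul_eq_mul, mul_one] at haddx
    refine mul_left_cancel₀ (Circle.coe_ne_zero (toCircle x)) ?_
    linear_combination hfx - haddx
  · have hcoeff := fourierCoeff_mulZ k (n + 1)
    rw [hk, fourierCoeff_Lp_add, fourierCoeff_Lp_smul, fourierCoeff_fourierBasis,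
      if_neg (by lia), mul_zero, add_zero, add_sub_cancel_right] at hcoeff
    rw [fourierCoeff_adjoint_shiftH2 _ hn, fourierCoeff_rieszProj _ (by lia),
      fourierCoeff_rieszProj _ hn, hcoeff]

theorem mem_toeplitz_domain_of_shiftH2_mem {g : H2} (hg : shiftH2 g ∈ (toeplitz ω).domain) :
    g ∈ (toeplitz ω).domain := by
  rw [LinearPMap.mem_domain_iff, toeplitz_graph] at hg ⊢
  obtain ⟨h, hgh⟩ := hg
  exact ⟨_, adjoint_shiftH2_mem_toeplitzGraph hgh⟩

theorem adjoint_shiftH2_comp_toeplitz_comp_shiftH2 (ω : RatFunc ℂ) :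
    (ContinuousLinearMap.adjoint shiftH2 : H2 →ₗ[ℂ] H2).compPMap
      (pmapCompCLM (toeplitz ω) shiftH2) = toeplitz ω := by
  refine LinearPMap.ext (le_antisymm (fun _ => mem_toeplitz_domain_of_shiftH2_mem)
    fun _ => shiftH2_mem_toeplitz_domain) fun g hSg hg => ?_
  have hgraph : (shiftH2 g, toeplitz ω ⟨shiftH2 g, hSg⟩) ∈ toeplitzGraph ω := by
    rw [← toeplitz_graph]
    exact (toeplitz ω).mem_graph ⟨shiftH2 g, hSg⟩
  rw [LinearPMap.image_iff hg, toeplitz_graph]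
  exact adjoint_shiftH2_mem_toeplitzGraph hgraph

theorem adjoint_shiftH2_mem_toeplitz_domain {f : H2} (hf : f ∈ (toeplitz ω).domain)
    (hf0 : fourierCoeff (f : L2T) 0 = 0) :
    ContinuousLinearMap.adjoint shiftH2 f ∈ (toeplitz ω).domain :=
  mem_toeplitz_domain_of_shiftH2_mem (by rwa [shiftH2_adjoint_of_fourierCoeff_zero hf0])

end SarasonAxioms

section Closedness

theorem isClosed_of_ker_le_of_finiteDimensional_map {𝕜 E F : Type*} [NontriviallyNormedField 𝕜]
    [CompleteSpace 𝕜] [AddCommGroup E] [Module 𝕜 E] [TopologicalSpace E] [AddCommGroup F]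
    [Module 𝕜 F] [TopologicalSpace F] [IsTopologicalAddGroup F] [ContinuousSMul 𝕜 F] [T2Space F]
    {S : Submodule 𝕜 E} (Φ : E →L[𝕜] F) (hker : (Φ : E →ₗ[𝕜] F).ker ≤ S)
    [FiniteDimensional 𝕜 (S.map (Φ : E →ₗ[𝕜] F))] : IsClosed (S : Set E) := by
  have hS : (S.map (Φ : E →ₗ[𝕜] F)).comap (Φ : E →ₗ[𝕜] F) = S := by
    rw [Submodule.comap_map_eq, sup_eq_left.2 hker]
  rw [← hS]
  exact (Submodule.closed_of_finiteDimensional (S.map (Φ : E →ₗ[𝕜] F))).preimage Φ.continuous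

/-- The map `(g, h) ↦ p g - q h`, where `ω = p / q` in lowest terms: clearing denominators in
`ω g - h` makes it a bounded operator. -/
noncomputable def clearDenom (ω : RatFunc ℂ) : H2 × H2 →L[ℂ] L2T :=
  (aeval mulZ ω.num ∘L H2.subtypeL).coprod (-(aeval mulZ ω.denom ∘L H2.subtypeL))

theorem clearDenom_apply (ω : RatFunc ℂ) (g h : H2) :
    clearDenom ω (g, h) = aeval mulZ ω.num (g : L2T) - aeval mulZ ω.denom (h : L2T) := by
  simp [clearDenom, sub_eq_add_neg]

theorem ker_clearDenom_le_toeplitzGraph (ω : RatFunc ℂ) :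
    (clearDenom ω : H2 × H2 →ₗ[ℂ] L2T).ker ≤ toeplitzGraph ω := by
  rintro ⟨g, h⟩ hgh
  have heq : aeval mulZ ω.num (g : L2T) = aeval mulZ ω.denom (h : L2T) := by
    rwa [LinearMap.mem_ker, ContinuousLinearMap.coe_coe, clearDenom_apply, sub_eq_zero] at hgh
  refine ⟨h, 0, .zero, ?_, (rieszProj_coe h).symm⟩
  filter_upwards [aeval_mulZ_coeFn ω.num (g : L2T), aeval_mulZ_coeFn ω.denom (h : L2T),
    circleEval_mul_denom ω, ae_eval_ne_zero ω.denom_ne_zero] with x hnum hdenom hω hne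
  rw [heq, hdenom, ← hω] at hnum
  rw [circleEval_zero, add_zero]
  refine mul_right_cancel₀ hne ?_
  linear_combination -hnum

theorem exists_clearDenom_eq {ω : RatFunc ℂ} {g : H2} {f : L2T} {ρ : RatFunc ℂ}
    (hρ : IsRatZeroT ρ)
    (hf : ∀ᵐ x : UnitAddCircle ∂haarAddCircle,
      circleEval ω x * (g : L2T) x = f x + circleEval ρ x) :
    ∃ t : ℂ[X], t.degree < ω.denom.degree ∧ clearDenom ω (g, rieszProj f) =
      aeval mulZ t (fourierBasis 0 : L2T) + aeval mulZ ω.denom (f - rieszProj f) := by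
  set u : L2T := aeval mulZ ω.num (g : L2T) - aeval mulZ ω.denom f
  have hu : u =ᵐ[haarAddCircle] fun x => ω.denom.eval (toCircle x : ℂ) * circleEval ρ x := by
    filter_upwards [hf, aeval_mulZ_coeFn ω.num (g : L2T), aeval_mulZ_coeFn ω.denom f,
      circleEval_mul_denom ω, Lp.coeFn_sub (aeval mulZ ω.num (g : L2T)) (aeval mulZ ω.denom f)]
      with x hfx hnum hdenom hω hsub
    rw [hsub, Pi.sub_apply, hnum, hdenom, ← hω]
    linear_combination ω.denom.eval (toCircle x : ℂ) * hfx
  obtain ⟨t, hdeg, ht⟩ := hρ.exists_algebraMap_mul_eq ω.denom_ne_zero u hu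
  have hut : u = aeval mulZ t (fourierBasis 0 : L2T) := by
    refine Lp.ext ?_
    filter_upwards [hu, circleEval_mul (algebraMap ℂ[X] (RatFunc ℂ) ω.denom) ρ,
      aeval_mulZ_coeFn t (fourierBasis 0 : L2T), fourierBasis_zero_coeFn] with x hux hmul htx hone
    rw [ht, circleEval_algebraMap, circleEval_algebraMap] at hmul
    rw [hux, htx, hone, mul_one, hmul]
  refine ⟨t, hdeg, ?_⟩
  rw [← hut, clearDenom_apply, map_sub]
  exact (sub_add_sub_cancel _ _ _).symm

theorem fourierCoeff_clearDenom_eq_zero {ω : RatFunc ℂ} {y : H2 × H2} (hy : y ∈ toeplitzGraph ω)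
    {n : ℤ} (hn : n ∉ Finset.Ico (0 : ℤ) ω.denom.natDegree) :
    fourierCoeff (clearDenom ω y) n = 0 := by
  obtain ⟨g, h⟩ := y
  rcases lt_or_ge n 0 with hneg | hnonneg
  · rw [clearDenom_apply]
    exact H2.sub_mem (aeval_mulZ_mem_H2 _ g) (aeval_mulZ_mem_H2 _ h) n hneg
  lift n to ℕ using hnonneg
  have hdeg_le : ω.denom.natDegree ≤ n := by simpa using hn
  obtain ⟨f, ρ, hρ, hf, rfl⟩ := hy
  obtain ⟨t, ht, hsplit⟩ := exists_clearDenom_eq hρ hf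
  have hcoanalytic (m : ℤ) (hm : 0 ≤ m) : fourierCoeff (f - rieszProj f : L2T) m = 0 := by
    rw [fourierCoeff_Lp_sub, fourierCoeff_rieszProj _ hm, sub_self]
  rw [hsplit, fourierCoeff_Lp_add, fourierCoeff_aeval_mulZ_fourierBasis_zero_eq_zero
    (ht.trans_le (natDegree_le_iff_degree_le.1 hdeg_le)),
    fourierCoeff_aeval_mulZ_eq_zero hcoanalytic (by exact_mod_cast hdeg_le), add_zero]

theorem isClosed_toeplitzGraph (ω : RatFunc ℂ) : IsClosed (toeplitzGraph ω : Set (H2 × H2)) := by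
  let s := Finset.Ico (0 : ℤ) ω.denom.natDegree
  have hmap : (toeplitzGraph ω).map (clearDenom ω : H2 × H2 →ₗ[ℂ] L2T) ≤
      Submodule.span ℂ (fourierBasis '' (s : Set ℤ)) := by
    rintro _ ⟨y, hy, rfl⟩
    exact mem_span_fourierBasis_of_fourierCoeff_eq_zero s fun n hn =>
      fourierCoeff_clearDenom_eq_zero hy hn
  have := FiniteDimensional.span_of_finite ℂ
    (s.finite_toSet.image (fourierBasis : ℤ → L2T))
  have := Submodule.finiteDimensional_of_le hmap
  exact isClosed_of_ker_le_of_finiteDimensional_map (clearDenom ω)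
    (ker_clearDenom_le_toeplitzGraph ω)

theorem isClosed_toeplitz (ω : RatFunc ℂ) : (toeplitz ω).IsClosed := by
  rw [LinearPMap.IsClosed, toeplitz_graph]
  exact isClosed_toeplitzGraph ω

end Closedness

theorem mainTheorem11 (ω : RatFunc ℂ) : IsSarasonToeplitz (toeplitz ω) where
  closed := isClosed_toeplitz ω
  dense_domain := dense_toeplitz_domain ω
  shift_mem _ := shiftH2_mem_toeplitz_domain
  adjoint_comp_comp := adjoint_shiftH2_comp_toeplitz_comp_shiftH2 ω
  backward_mem _ := adjoint_shiftH2_mem_toeplitz_domain
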